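/- Let $n\ge 1$ and let $M$ be a non-empty smooth manifold of dimension $2n+1$ with an almost contact B-metric structure $(\varphi,\xi,\eta,g)$: $\varphi$ is a smooth field of endomorphisms of $TM$, $\xi$ a smooth vector field, $\eta$ a smooth 1-form and $g$ a pseudo-Riemannian metric of signature $(n+1,n)$ such that $$\varphi\xi=0,\quad \varphi^2=-\mathrm{Id}+\eta\otimes\xi,\quad \eta\circ\varphi=0,\quad \eta(\xi)=1,\quad g(\varphi x,\varphi y)=-g(x,y)+\eta(x)\eta(y).$$ Let $\tilde g(x,y)=g(x,\varphi y)+\eta(x)\eta(y)$ be the associated metric, $\nabla$ the Levi-Civita connection of $g$, $R(x,y)z=\nabla_x\nabla_yz-\nabla_y\nabla_xz-\nabla_{[x,y]}z$ its curvature tensor, $\rho(y,z)=\operatorname{tr}(x\mapsto R(x,y)z)$ its Ricci tensor and $\tau$ its scalar curvature, the trace of $\rho$ with respect to $g$. Let $(\operatorname{div}\rho)(z)=g^{ij}(\nabla_{e_i}\rho)(e_j,z)$ and $(\operatorname{div}^*\rho)(z)=\tilde g^{ij}(\nabla_{e_i}\rho)(e_j,z)$ be the traces of $(x,y)\mapsto(\nabla_x\rho)(y,z)$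 with respect to $g$ and $\tilde g$, respectively (with the same $\nabla$ and $\rho$). Suppose that $M$ is Sasaki-like, that is, $$(\nabla_x\varphi)y=-g(x,y)\xi-\eta(y)x+2\eta(x)\eta(y)\xi,$$ and Einstein-like with real constants $(a,b,c)$, that is, $\rho=a\,g+b\,\tilde g+c\,\eta\otimes\eta$. Then $$a+b+c=2n,\qquad \tau=2n(a+1),$$ $$(\nabla_x\rho)(y,z)=-(b+c)\{g(x,\varphi y)\eta(z)+g(x,\varphi z)\eta(y)\}+b\{g(\varphi x,\varphi y)\eta(z)+g(\varphi x,\varphi z)\eta(y)\}$$ for all tangent vectors $x,y,z$ at any point of $M$, and, at every point of $M$, $$a=2n+\tfrac{1}{2n}(\operatorname{div}^*\rho)(\xi),\qquad b=-\tfrac{1}{2n}(\operatorname{div}\rho)(\xi),\qquad c=\tfrac{1}{2n}\{(\operatorname{div}\rho)(\xi)-(\operatorname{div}^*\rho)(\xi)\}.$$ -/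

import Mathlib

open scoped Manifold ContDiff

noncomputable section

section PseudoRiemannian

variable {E : Type*} [NormedAddCommGroup E] [NormedSpace ℝ E]
  {H : Type*} [TopologicalSpace H] (I : ModelWithCorners ℝ E H)
  (M : Type*) [TopologicalSpace M] [ChartedSpace H M] [IsManifold I ∞ M]

/-- A smooth pseudo-Riemannian metric: a smooth field of nondegenerate symmetric bilinear forms
on the tangent spaces. -/
structure PseudoRiemannianMetric where
  /-- The scalar product on each tangent space. -/
  val (p : M) : TangentSpace I p →L[ℝ] TangentSpace I p →L[ℝ] ℝ
  symm (p : M) (u v : TangentSpace I p) : val p u v = val p v u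
  nondegenerate (p : M) (u : TangentSpace I p) (hu : ∀ v, val p u v = 0) : u = 0
  contMDiff : ContMDiff I (I.prod 𝓘(ℝ, E →L[ℝ] E →L[ℝ] ℝ)) ∞
    (fun p ↦ Bundle.TotalSpace.mk' (E →L[ℝ] E →L[ℝ] ℝ) p (val p))

end PseudoRiemannian

namespace PseudoRiemannianMetric

open VectorField

variable {E : Type*} [NormedAddCommGroup E] [NormedSpace ℝ E]
  {H : Type*} [TopologicalSpace H] {I : ModelWithCorners ℝ E H}
  {M : Type*} [TopologicalSpace M] [ChartedSpace H M] [IsManifold I ∞ M]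
  (g : PseudoRiemannianMetric I M)

/-- The right-hand side of the Koszul formula for `g (∇_X Y, Z)`. -/
def koszul (Y X Z : Π p : M, TangentSpace I p) (p : M) : ℝ :=
  (1 / 2) * (mvfderiv I (fun q ↦ g.val q (Y q) (Z q)) p (X p)
    + mvfderiv I (fun q ↦ g.val q (X q) (Z q)) p (Y p)
    - mvfderiv I (fun q ↦ g.val q (X q) (Y q)) p (Z p)
    + g.val p (mlieBracket I X Y p) (Z p)
    - g.val p (mlieBracket I X Z p) (Y p)
    - g.val p (mlieBracket I Y Z p) (X p))

theorem mdifferentiableAt_apply {X Y : Π p : M, TangentSpace I p} {p : M}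
    (hX : MDiffAt (T% X) p) (hY : MDiffAt (T% Y) p) :
    MDiffAt (fun q ↦ g.val q (X q) (Y q)) p := by
  have : MDifferentiableAt I (I.prod 𝓘(ℝ))
      (fun m ↦ Bundle.TotalSpace.mk' ℝ (E := Bundle.Trivial M ℝ) m (g.val m (X m) (Y m))) p := by
    apply MDifferentiableAt.clm_bundle_apply₂ (F₁ := E) (F₂ := E)
    · exact g.contMDiff.mdifferentiableAt (by simp)
    · exact hX
    · exact hY
  simp only [mdifferentiableAt_totalSpace] at this
  exact this.2

variable [CompleteSpace E]

theorem tensorialAt_koszul_left {Y Z : Π p : M, TangentSpace I p} {p : M}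
    (hY : MDiffAt (T% Y) p) (hZ : MDiffAt (T% Z) p) :
    TensorialAt I E (fun X ↦ g.koszul Y X Z p) p where
  smul {f X} hf hX := by
    have h1 : mvfderiv I (fun q ↦ g.val q ((f • X) q) (Z q)) p
        = f p • mvfderiv I (fun q ↦ g.val q (X q) (Z q)) p
          + g.val p (X p) (Z p) • mvfderiv I f p := by
      rw [← mvfderiv_fun_mul hf (g.mdifferentiableAt_apply hX hZ)]
      simp
    have h2 : mvfderiv I (fun q ↦ g.val q ((f • X) q) (Y q)) p
        = f p • mvfderiv I (fun q ↦ g.val q (X q) (Y q)) p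
          + g.val p (X p) (Y p) • mvfderiv I f p := by
      rw [← mvfderiv_fun_mul hf (g.mdifferentiableAt_apply hX hY)]
      simp
    simp only [koszul, h1, h2, mlieBracket_smul_left hf hX]
    simp
    ring
  add {X X'} hX hX' := by
    have h1 : mvfderiv I (fun q ↦ g.val q ((X + X') q) (Z q)) p
        = mvfderiv I (fun q ↦ g.val q (X q) (Z q)) p
          + mvfderiv I (fun q ↦ g.val q (X' q) (Z q)) p := by
      rw [← mvfderiv_fun_add (g.mdifferentiableAt_apply hX hZ) (g.mdifferentiableAt_apply hX' hZ)]
      simp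
    have h2 : mvfderiv I (fun q ↦ g.val q ((X + X') q) (Y q)) p
        = mvfderiv I (fun q ↦ g.val q (X q) (Y q)) p
          + mvfderiv I (fun q ↦ g.val q (X' q) (Y q)) p := by
      rw [← mvfderiv_fun_add (g.mdifferentiableAt_apply hX hY) (g.mdifferentiableAt_apply hX' hY)]
      simp
    simp only [koszul, h1, h2, mlieBracket_add_left hX hX']
    simp
    ring

theorem tensorialAt_koszul_right {Y X : Π p : M, TangentSpace I p} {p : M}
    (hY : MDiffAt (T% Y) p) (hX : MDiffAt (T% X) p) :
    TensorialAt I E (fun Z ↦ g.koszul Y X Z p) p where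
  smul {f Z} hf hZ := by
    have h1 : mvfderiv I (fun q ↦ g.val q (Y q) ((f • Z) q)) p
        = f p • mvfderiv I (fun q ↦ g.val q (Y q) (Z q)) p
          + g.val p (Y p) (Z p) • mvfderiv I f p := by
      rw [← mvfderiv_fun_mul hf (g.mdifferentiableAt_apply hY hZ)]
      simp
    have h2 : mvfderiv I (fun q ↦ g.val q (X q) ((f • Z) q)) p
        = f p • mvfderiv I (fun q ↦ g.val q (X q) (Z q)) p
          + g.val p (X p) (Z p) • mvfderiv I f p := by
      rw [← mvfderiv_fun_mul hf (g.mdifferentiableAt_apply hX hZ)]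
      simp
    simp only [koszul, h1, h2, mlieBracket_smul_right hf hZ]
    simp [g.symm p (Z p)]
    ring
  add {Z Z'} hZ hZ' := by
    have h1 : mvfderiv I (fun q ↦ g.val q (Y q) ((Z + Z') q)) p
        = mvfderiv I (fun q ↦ g.val q (Y q) (Z q)) p
          + mvfderiv I (fun q ↦ g.val q (Y q) (Z' q)) p := by
      rw [← mvfderiv_fun_add (g.mdifferentiableAt_apply hY hZ) (g.mdifferentiableAt_apply hY hZ')]
      simp
    have h2 : mvfderiv I (fun q ↦ g.val q (X q) ((Z + Z') q)) p
        = mvfderiv I (fun q ↦ g.val q (X q) (Z q)) p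
          + mvfderiv I (fun q ↦ g.val q (X q) (Z' q)) p := by
      rw [← mvfderiv_fun_add (g.mdifferentiableAt_apply hX hZ) (g.mdifferentiableAt_apply hX hZ')]
      simp
    simp only [koszul, h1, h2, mlieBracket_add_right hZ hZ']
    simp
    ring

theorem koszul_add {Y Y' X Z : Π p : M, TangentSpace I p} {p : M}
    (hY : MDiffAt (T% Y) p) (hY' : MDiffAt (T% Y') p)
    (hX : MDiffAt (T% X) p) (hZ : MDiffAt (T% Z) p) :
    g.koszul (Y + Y') X Z p = g.koszul Y X Z p + g.koszul Y' X Z p := by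
  have h1 : mvfderiv I (fun q ↦ g.val q ((Y + Y') q) (Z q)) p
      = mvfderiv I (fun q ↦ g.val q (Y q) (Z q)) p
        + mvfderiv I (fun q ↦ g.val q (Y' q) (Z q)) p := by
    rw [← mvfderiv_fun_add (g.mdifferentiableAt_apply hY hZ) (g.mdifferentiableAt_apply hY' hZ)]
    simp
  have h2 : mvfderiv I (fun q ↦ g.val q (X q) ((Y + Y') q)) p
      = mvfderiv I (fun q ↦ g.val q (X q) (Y q)) p
        + mvfderiv I (fun q ↦ g.val q (X q) (Y' q)) p := by
    rw [← mvfderiv_fun_add (g.mdifferentiableAt_apply hX hY) (g.mdifferentiableAt_apply hX hY')]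
    simp
  simp only [koszul, h1, h2, mlieBracket_add_right hY hY', mlieBracket_add_left hY hY']
  simp
  ring

theorem koszul_smul {f : M → ℝ} {Y X Z : Π p : M, TangentSpace I p} {p : M}
    (hf : MDiffAt f p) (hY : MDiffAt (T% Y) p)
    (hX : MDiffAt (T% X) p) (hZ : MDiffAt (T% Z) p) :
    g.koszul (f • Y) X Z p
      = f p * g.koszul Y X Z p + mvfderiv I f p (X p) * g.val p (Y p) (Z p) := by
  have h1 : mvfderiv I (fun q ↦ g.val q ((f • Y) q) (Z q)) p
      = f p • mvfderiv I (fun q ↦ g.val q (Y q) (Z q)) p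
        + g.val p (Y p) (Z p) • mvfderiv I f p := by
    rw [← mvfderiv_fun_mul hf (g.mdifferentiableAt_apply hY hZ)]
    simp
  have h2 : mvfderiv I (fun q ↦ g.val q (X q) ((f • Y) q)) p
      = f p • mvfderiv I (fun q ↦ g.val q (X q) (Y q)) p
        + g.val p (X p) (Y p) • mvfderiv I f p := by
    rw [← mvfderiv_fun_mul hf (g.mdifferentiableAt_apply hX hY)]
    simp
  simp only [koszul, h1, h2, mlieBracket_smul_right hf hY, mlieBracket_smul_left hf hY]
  simp [g.symm p (Y p) (X p)]
  ring

variable [FiniteDimensional ℝ E]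

instance (p : M) : FiniteDimensional ℝ (TangentSpace I p) :=
  inferInstanceAs (FiniteDimensional ℝ E)

/-- The isomorphism `u ↦ g (u, ·)` of a tangent space with its dual. -/
def flat (p : M) : TangentSpace I p ≃ₗ[ℝ] (TangentSpace I p →L[ℝ] ℝ) :=
  LinearEquiv.ofBijective (g.val p).toLinearMap <| by
    have : T2Space (TangentSpace I p) := inferInstanceAs (T2Space E)
    have hinj : Function.Injective (g.val p).toLinearMap :=
      (injective_iff_map_eq_zero _).2 fun u hu ↦ g.nondegenerate p u fun v ↦ by
        simpa using congr($hu v)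
    have hfin : Module.finrank ℝ (TangentSpace I p)
        = Module.finrank ℝ (TangentSpace I p →L[ℝ] ℝ) := by
      rw [← (LinearMap.toContinuousLinearMap :
        (TangentSpace I p →ₗ[ℝ] ℝ) ≃ₗ[ℝ] (TangentSpace I p →L[ℝ] ℝ)).finrank_eq]
      exact (Subspace.dual_finrank_eq (K := ℝ) (V := TangentSpace I p)).symm
    exact ⟨hinj, (LinearMap.injective_iff_surjective_of_finrank_eq_finrank hfin).1 hinj⟩

@[simp] theorem val_flat_symm (p : M) (α : TangentSpace I p →L[ℝ] ℝ) (v : TangentSpace I p) :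
    g.val p ((g.flat p).symm α) v = α v :=
  congr($((g.flat p).apply_symm_apply α) v)

/-- The Levi-Civita connection as an operator on vector fields: where `Y` is differentiable,
`∇_X Y` is the vector field with `g (∇_X Y, Z)` given by the Koszul formula for all `Z`. -/
def leviCivitaFun (Y : Π p : M, TangentSpace I p) (p : M) :
    TangentSpace I p →L[ℝ] TangentSpace I p :=
  open Classical in
  have : T2Space (TangentSpace I p) := inferInstanceAs (T2Space E)
  if hY : MDiffAt (T% Y) p then
    LinearMap.toContinuousLinearMap ((g.flat p).symm.toLinearMap ∘ₗ
      (TensorialAt.mkHom₂ (fun X Z ↦ g.koszul Y X Z p) p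
        (fun _ hZ ↦ g.tensorialAt_koszul_left hY hZ)
        (fun _ hX ↦ g.tensorialAt_koszul_right hY hX)).toLinearMap)
  else 0

theorem val_leviCivitaFun {Y X Z : Π p : M, TangentSpace I p} {p : M}
    (hY : MDiffAt (T% Y) p) (hX : MDiffAt (T% X) p) (hZ : MDiffAt (T% Z) p) :
    g.val p (g.leviCivitaFun Y p (X p)) (Z p) = g.koszul Y X Z p := by
  rw [leviCivitaFun, dif_pos hY]
  have h := TensorialAt.mkHom₂_apply (Φ := fun X Z ↦ g.koszul Y X Z p)
    (fun _ hZ ↦ g.tensorialAt_koszul_left hY hZ)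
    (fun _ hX ↦ g.tensorialAt_koszul_right hY hX) hX hZ
  simpa using h

theorem eq_of_val_eq {p : M} {u v : TangentSpace I p} (h : ∀ w, g.val p u w = g.val p v w) :
    u = v :=
  sub_eq_zero.1 <| g.nondegenerate p _ fun w ↦ by simp [h w]

/-- The Levi-Civita connection of a pseudo-Riemannian metric. In Mathlib's argument order
`g.leviCivita Y p u` is `∇_u Y` at `p`. -/
def leviCivita : CovariantDerivative I E (TangentSpace I : M → Type _) where
  toFun := g.leviCivitaFun
  isCovariantDerivativeOnUniv :=
    { add := fun {Y Y' p} hY hY' _ ↦ by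
        ext u
        refine g.eq_of_val_eq fun w ↦ ?_
        have hu := FiberBundle.mdifferentiableAt_extend I E u
        have hw := FiberBundle.mdifferentiableAt_extend I E w
        have h := g.koszul_add hY hY' hu hw
        rw [← g.val_leviCivitaFun (mdifferentiableAt_add_section hY hY') hu hw,
          ← g.val_leviCivitaFun hY hu hw, ← g.val_leviCivitaFun hY' hu hw] at h
        simpa using h
      leibniz := fun {Y f p} hY hf _ ↦ by
        ext u
        refine g.eq_of_val_eq fun w ↦ ?_
        have hu := FiberBundle.mdifferentiableAt_extend I E u
        have hw := FiberBundle.mdifferentiableAt_extend I E w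
        have h := g.koszul_smul hf hY hu hw
        rw [← g.val_leviCivitaFun (hf.smul_section hY) hu hw,
          ← g.val_leviCivitaFun hY hu hw] at h
        simpa using h }

/-- The Levi-Civita connection is torsion-free. -/
theorem leviCivita_torsionFree {X Y : Π p : M, TangentSpace I p} {p : M}
    (hX : MDiffAt (T% X) p) (hY : MDiffAt (T% Y) p) :
    g.leviCivita Y p (X p) - g.leviCivita X p (Y p) = mlieBracket I X Y p := by
  refine g.eq_of_val_eq fun w ↦ ?_
  have hw := FiberBundle.mdifferentiableAt_extend I E w
  have h1 := g.val_leviCivitaFun hY hX hw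
  have h2 := g.val_leviCivitaFun hX hY hw
  rw [FiberBundle.extend_apply_self] at h1 h2
  change g.val p (g.leviCivitaFun Y p (X p) - g.leviCivitaFun X p (Y p)) w = _
  simp only [map_sub, sub_apply, h1, h2, koszul,
    FiberBundle.extend_apply_self, mlieBracket_swap_apply (V := Y) (W := X)]
  simp only [g.symm _ (Y _) (X _)]
  simp
  ring

/-- The Levi-Civita connection is compatible with the metric. -/
theorem leviCivita_metric {X Y Z : Π p : M, TangentSpace I p} {p : M}
    (hX : MDiffAt (T% X) p) (hY : MDiffAt (T% Y) p) (hZ : MDiffAt (T% Z) p) :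
    mvfderiv I (fun q ↦ g.val q (Y q) (Z q)) p (X p)
      = g.val p (g.leviCivita Y p (X p)) (Z p) + g.val p (Y p) (g.leviCivita Z p (X p)) := by
  rw [g.symm p (Y p)]
  change _ = g.val p (g.leviCivitaFun Y p (X p)) (Z p)
    + g.val p (g.leviCivitaFun Z p (X p)) (Y p)
  rw [g.val_leviCivitaFun hY hX hZ, g.val_leviCivitaFun hZ hX hY]
  simp only [koszul, mlieBracket_swap_apply (V := Z) (W := Y), g.symm _ (Z _) (Y _)]
  simp
  ring

/-- The curvature tensor `R(u,v)w = ∇_U ∇_V W - ∇_V ∇_U W - ∇_[U,V] W` at `p`, where `U`, `V`, `W`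
are vector fields, smooth near `p`, that extend the tangent vectors `u`, `v`, `w`. -/
def curvature (p : M) (u v w : TangentSpace I p) : TangentSpace I p :=
  letI U := FiberBundle.extend E u
  letI V := FiberBundle.extend E v
  letI W := FiberBundle.extend E w
  g.leviCivita (fun q ↦ g.leviCivita W q (V q)) p u
    - g.leviCivita (fun q ↦ g.leviCivita W q (U q)) p v
    - g.leviCivita W p (mlieBracket I U V p)

variable (I) in
/-- A basis of the tangent space, used to compute traces. -/
def tangentBasis (p : M) : Module.Basis (Fin (Module.finrank ℝ E)) ℝ (TangentSpace I p) :=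
  Module.finBasis ℝ E

/-- The Ricci tensor `ρ(v,w)`, the trace of `u ↦ R(u,v)w`. -/
def ricci (p : M) (v w : TangentSpace I p) : ℝ :=
  ∑ i, (tangentBasis I p).repr (g.curvature p (tangentBasis I p i) v w) i

/-- The trace `h^{ij} T(e_i, e_j)` of a bilinear form `T` with respect to a nondegenerate
bilinear form `h`, where `(h^{ij})` is the inverse of the matrix `(h(e_i, e_j))`. -/
def traceWith {p : M} (h T : TangentSpace I p → TangentSpace I p → ℝ) : ℝ :=
  ∑ i, ∑ j, (Matrix.of fun i j ↦ h (tangentBasis I p i) (tangentBasis I p j))⁻¹ i j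
    * T (tangentBasis I p i) (tangentBasis I p j)

/-- The scalar curvature `τ = g^{ij} ρ_{ij}`. -/
def scalarCurvature (p : M) : ℝ :=
  traceWith (fun u v ↦ g.val p u v) (g.ricci p)

/-- The covariant derivative of a field of bilinear forms:
`(∇_u T)(v,w) = u(T(V,W)) - T(∇_u V, w) - T(v, ∇_u W)`, where `V`, `W` are vector fields, smooth
near `p`, that extend `v`, `w`. -/
def covDerivBilin (T : Π p : M, TangentSpace I p → TangentSpace I p → ℝ) (p : M)
    (u v w : TangentSpace I p) : ℝ :=
  letI V := FiberBundle.extend E v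
  letI W := FiberBundle.extend E w
  mvfderiv I (fun q ↦ T q (V q) (W q)) p u
    - T p (g.leviCivita V p u) w - T p v (g.leviCivita W p u)

/-- The covariant derivative of a field of endomorphisms:
`(∇_u φ)v = ∇_u (φ V) - φ (∇_u V)`, where `V` is a vector field, smooth near `p`, that extends
`v`. -/
def covDerivEnd (φ : Π p : M, TangentSpace I p →L[ℝ] TangentSpace I p) (p : M)
    (u v : TangentSpace I p) : TangentSpace I p :=
  letI V := FiberBundle.extend E v
  g.leviCivita (fun q ↦ φ q (V q)) p u - φ p (g.leviCivita V p u)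

/-- The divergence `h^{ij} (∇_{e_i} T)(e_j, z)` of a field of bilinear forms, where `∇` is the
Levi-Civita connection of `g` and the trace is taken with respect to `h`. -/
def divergenceWith (h T : Π p : M, TangentSpace I p → TangentSpace I p → ℝ) (p : M)
    (z : TangentSpace I p) : ℝ :=
  traceWith (h p) (fun x y ↦ g.covDerivBilin T p x y z)

end PseudoRiemannianMetric

/-- An almost contact B-metric structure `(φ, ξ, η, g)` on a manifold of dimension `2n+1`. -/
structure AlmostContactBMetric (n : ℕ) (M : Type*) [TopologicalSpace M]
    [ChartedSpace (EuclideanSpace ℝ (Fin (2 * n + 1))) M] [IsManifold (𝓡 (2 * n + 1)) ∞ M] where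
  φ (p : M) : TangentSpace (𝓡 (2 * n + 1)) p →L[ℝ] TangentSpace (𝓡 (2 * n + 1)) p
  ξ (p : M) : TangentSpace (𝓡 (2 * n + 1)) p
  η (p : M) : TangentSpace (𝓡 (2 * n + 1)) p →L[ℝ] ℝ
  g : PseudoRiemannianMetric (𝓡 (2 * n + 1)) M
  contMDiff_φ : ContMDiff (𝓡 (2 * n + 1))
    ((𝓡 (2 * n + 1)).prod 𝓘(ℝ, EuclideanSpace ℝ (Fin (2 * n + 1)) →L[ℝ]
      EuclideanSpace ℝ (Fin (2 * n + 1)))) ∞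
    (fun p ↦ Bundle.TotalSpace.mk' (EuclideanSpace ℝ (Fin (2 * n + 1)) →L[ℝ]
      EuclideanSpace ℝ (Fin (2 * n + 1)))
      (E := fun p : M ↦ TangentSpace (𝓡 (2 * n + 1)) p →L[ℝ] TangentSpace (𝓡 (2 * n + 1)) p)
      p (φ p))
  contMDiff_ξ : ContMDiff (𝓡 (2 * n + 1)) (𝓡 (2 * n + 1)).tangent ∞
    (fun p ↦ (⟨p, ξ p⟩ : TangentBundle (𝓡 (2 * n + 1)) M))
  contMDiff_η : ContMDiff (𝓡 (2 * n + 1))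
    ((𝓡 (2 * n + 1)).prod 𝓘(ℝ, EuclideanSpace ℝ (Fin (2 * n + 1)) →L[ℝ] ℝ)) ∞
    (fun p ↦ Bundle.TotalSpace.mk' (EuclideanSpace ℝ (Fin (2 * n + 1)) →L[ℝ] ℝ)
      (E := fun p : M ↦ TangentSpace (𝓡 (2 * n + 1)) p →L[ℝ] ℝ) p (η p))
  φ_ξ (p : M) : φ p (ξ p) = 0
  φ_φ (p : M) (x : TangentSpace (𝓡 (2 * n + 1)) p) : φ p (φ p x) = -x + η p x • ξ p
  η_φ (p : M) (x : TangentSpace (𝓡 (2 * n + 1)) p) : η p (φ p x) = 0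
  η_ξ (p : M) : η p (ξ p) = 1
  g_φ_φ (p : M) (x y : TangentSpace (𝓡 (2 * n + 1)) p) :
    g.val p (φ p x) (φ p y) = -g.val p x y + η p x * η p y
  /-- The metric has signature `(n+1, n)`. -/
  signature (p : M) : sigPos (g.val p).toBilinForm.toQuadraticMap = n + 1 ∧
    sigNeg (g.val p).toBilinForm.toQuadraticMap = n

namespace AlmostContactBMetric

variable {n : ℕ} {M : Type*} [TopologicalSpace M]
  [ChartedSpace (EuclideanSpace ℝ (Fin (2 * n + 1))) M] [IsManifold (𝓡 (2 * n + 1)) ∞ M]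
  (S : AlmostContactBMetric n M)

/-- The associated metric `g̃(x,y) = g(x, φy) + η(x)η(y)`. -/
def assocMetric (p : M) (x y : TangentSpace (𝓡 (2 * n + 1)) p) : ℝ :=
  S.g.val p x (S.φ p y) + S.η p x * S.η p y

/-- The Ricci tensor of `g`. -/
def ρ (p : M) (x y : TangentSpace (𝓡 (2 * n + 1)) p) : ℝ := S.g.ricci p x y

/-- The scalar curvature of `g`. -/
def τ (p : M) : ℝ := S.g.scalarCurvature p

/-- `(∇_x ρ)(y,z)`. -/
def nablaRho (p : M) (x y z : TangentSpace (𝓡 (2 * n + 1)) p) : ℝ :=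
  S.g.covDerivBilin S.ρ p x y z

/-- `(div ρ)(z)`, the trace of `(x,y) ↦ (∇_x ρ)(y,z)` with respect to `g`. -/
def divRho (p : M) (z : TangentSpace (𝓡 (2 * n + 1)) p) : ℝ :=
  S.g.divergenceWith (fun q x y ↦ S.g.val q x y) S.ρ p z

/-- `(div* ρ)(z)`, the trace of `(x,y) ↦ (∇_x ρ)(y,z)` with respect to the associated metric. -/
def divStarRho (p : M) (z : TangentSpace (𝓡 (2 * n + 1)) p) : ℝ :=
  S.g.divergenceWith S.assocMetric S.ρ p z

/-- Sasaki-like: `(∇_x φ)y = -g(x,y)ξ - η(y)x + 2η(x)η(y)ξ`. -/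
def IsSasakiLike : Prop :=
  ∀ (p : M) (x y : TangentSpace (𝓡 (2 * n + 1)) p),
    S.g.covDerivEnd S.φ p x y =
      -(S.g.val p x y • S.ξ p) - S.η p y • x + (2 * S.η p x * S.η p y) • S.ξ p

/-- Einstein-like with constants `(a,b,c)`: `ρ = a g + b g̃ + c η ⊗ η`. -/
def IsEinsteinLike (a b c : ℝ) : Prop :=
  ∀ (p : M) (x y : TangentSpace (𝓡 (2 * n + 1)) p),
    S.ρ p x y = a * S.g.val p x y + b * S.assocMetric p x y + c * (S.η p x * S.η p y)

end AlmostContactBMetric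

end

noncomputable section

namespace PseudoRiemannianMetric

open VectorField Filter Topology

variable {E : Type*} [NormedAddCommGroup E] [NormedSpace ℝ E]
  {H : Type*} [TopologicalSpace H] {I : ModelWithCorners ℝ E H}
  {M : Type*} [TopologicalSpace M] [ChartedSpace H M]

theorem _root_.ContMDiffAt.matrix_det {ι : Type*} [Fintype ι] [DecidableEq ι] {p : M}
    {A : M → Matrix ι ι ℝ} (hA : ∀ i j, CMDiffAt ∞ (fun q ↦ A q i j) p) :
    CMDiffAt ∞ (fun q ↦ (A q).det) p := by
  simp only [Matrix.det_apply']
  exact ContMDiffAt.sum fun σ _ ↦ contMDiffAt_const.mul (ContMDiffAt.prod fun i _ ↦ hA _ _)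

theorem _root_.Filter.EventuallyEq.mvfderiv_eq {f f' : M → ℝ} {p : M} (h : f =ᶠ[𝓝 p] f') :
    mvfderiv I f p = mvfderiv I f' p := by
  ext v
  simpa using! congr($(h.mfderiv_eq (I := I) (I' := 𝓘(ℝ))) v)

variable [IsManifold I ∞ M]

theorem _root_.ContMDiffAt.mvfderiv_apply {f : M → ℝ} {V : Π p : M, TangentSpace I p} {p : M}
    (hf : CMDiffAt ∞ f p) (hV : CMDiffAt ∞ (T% V) p) :
    CMDiffAt ∞ (fun q ↦ mvfderiv I f q (V q)) p := by
  have h1 := hf.mfderiv_const (m := ∞) (by simp)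
  have h2 := ContMDiffAt.clm_apply_of_inCoordinates h1 hV hf
  rw [Bundle.contMDiffAt_totalSpace] at h2
  simpa using! h2.2

theorem _root_.ContMDiffAt.eventually_mdifferentiableAt {Y : Π p : M, TangentSpace I p} {p : M}
    (hY : CMDiffAt ∞ (T% Y) p) : ∀ᶠ q in 𝓝 p, MDiffAt (T% Y) q :=
  ((contMDiffAt_iff_contMDiffAt_nhds (by simp)).1 (ContMDiffAt.of_le hY (m := 1) (by simp))).mono
    fun _ h ↦ h.mdifferentiableAt one_ne_zero

theorem _root_.ContMDiffAt.eventually_mdifferentiableAt_fun {f : M → ℝ} {p : M}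
    (hY : CMDiffAt ∞ f p) : ∀ᶠ q in 𝓝 p, MDiffAt f q :=
  ((contMDiffAt_iff_contMDiffAt_nhds (by simp)).1 (ContMDiffAt.of_le hY (m := 1) (by simp))).mono
    fun _ h ↦ h.mdifferentiableAt one_ne_zero

theorem contMDiffAt_mlieBracket [CompleteSpace E] {U V : Π p : M, TangentSpace I p} {p : M}
    (hU : CMDiffAt ∞ (T% U) p) (hV : CMDiffAt ∞ (T% V) p) :
    CMDiffAt ∞ (T% (mlieBracket I U V)) p := by
  have : IsManifold I ((⊤ : ℕ∞) + 1 : ℕ∞ω) M := by simpa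
  have : IsManifold I (minSmoothness ℝ 2) M :=
    .of_le (n := ∞) (by simpa using WithTop.coe_le_coe.2 (le_top : (2 : ℕ∞) ≤ ⊤))
  exact ContMDiffAt.mlieBracket_vectorField (n := ⊤) (m := ⊤) hU hV (by simp)

variable (g : PseudoRiemannianMetric I M)

theorem contMDiffAt_apply {X Y : Π p : M, TangentSpace I p} {p : M}
    (hX : CMDiffAt ∞ (T% X) p) (hY : CMDiffAt ∞ (T% Y) p) :
    CMDiffAt ∞ (fun q ↦ g.val q (X q) (Y q)) p := by
  have : ContMDiffAt I (I.prod 𝓘(ℝ)) ∞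
      (fun m ↦ Bundle.TotalSpace.mk' ℝ (E := Bundle.Trivial M ℝ) m (g.val m (X m) (Y m))) p := by
    apply ContMDiffAt.clm_bundle_apply₂ (F₁ := E) (F₂ := E)
    · exact g.contMDiff.contMDiffAt
    · exact hX
    · exact hY
  rw [Bundle.contMDiffAt_totalSpace] at this
  exact this.2

section
variable [FiniteDimensional ℝ E]

theorem contMDiffAt_of_val {σ : Π p : M, TangentSpace I p} {p : M}
    (h : ∀ Z : Π p : M, TangentSpace I p, CMDiffAt ∞ (T% Z) p →
      CMDiffAt ∞ (fun q ↦ g.val q (σ q) (Z q)) p) :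
    CMDiffAt ∞ (T% σ) p := by
  let t := trivializationAt E (TangentSpace I : M → Type _) p
  let b := Module.finBasis ℝ E
  have hp : p ∈ t.baseSet := FiberBundle.mem_baseSet_trivializationAt' p
  have hframe := t.isLocalFrameOn_localFrame_baseSet I ∞ b
  set s := t.localFrame b
  have hs : ∀ i, CMDiffAt ∞ (T% (s i)) p := fun i ↦ hframe.contMDiffAt t.open_baseSet hp i
  let G : M → Matrix _ _ ℝ := fun q ↦ Matrix.of fun i j ↦ g.val q (s j q) (s i q)
  have hG : ∀ i j, CMDiffAt ∞ (fun q ↦ G q i j) p := fun i j ↦ g.contMDiffAt_apply (hs j) (hs i)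
  let k : M → _ → ℝ := fun q i ↦ g.val q (σ q) (s i q)
  have hdet : ∀ q ∈ t.baseSet, (G q).det ≠ 0 := by
    intro q hq hzero
    obtain ⟨v, hv, hGv⟩ := Matrix.exists_mulVec_eq_zero_iff.2 hzero
    have hu : ∑ j, v j • s j q = 0 := by
      refine g.nondegenerate q _ fun w ↦ ?_
      have hw : w = ∑ i, hframe.coeff i q w • s i q := by
        simpa using ((hframe.toBasisAt hq).sum_repr w).symm.trans (by simp [IsLocalFrameOn.coeff, hq])
      rw [hw]
      simp only [map_sum, map_smul]
      refine Finset.sum_eq_zero fun i _ ↦ ?_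
      have := congr_fun hGv i
      simp only [Matrix.mulVec, dotProduct, G, Matrix.of_apply, Pi.zero_apply] at this
      simp [mul_comm (v _), this]
    exact hv (funext fun i ↦ Fintype.linearIndependent_iff.1 (hframe.linearIndependent hq) v hu i)
  refine hframe.contMDiffAt_of_coeff (fun i ↦ ?_) (t.open_baseSet.mem_nhds hp)
  have hc : ∀ᶠ q in 𝓝 p, hframe.coeff i q (σ q) = (G q).det⁻¹ * (G q).cramer (k q) i := by
    filter_upwards [t.open_baseSet.mem_nhds hp] with q hq
    have : (G q).mulVec (fun j ↦ hframe.coeff j q (σ q)) = k q := by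
      ext i
      simp only [k]
      conv_rhs => rw [hframe.coeff_sum_eq σ hq]
      simp [Matrix.mulVec, dotProduct, G, mul_comm]
    rw [← this, Matrix.cramer_eq_adjugate_mulVec, Matrix.mulVec_mulVec, Matrix.adjugate_mul]
    simp [Matrix.smul_mulVec, hdet q hq]
  refine ContMDiffAt.congr_of_eventuallyEq ?_ hc
  simp only [Matrix.cramer_apply]
  have hd := (ContMDiffAt.matrix_det hG)
  refine ContMDiffAt.mul (hd.inv₀ (hdet p hp)) (ContMDiffAt.matrix_det fun i' j ↦ ?_)
  by_cases hj : j = i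
  · simpa [Matrix.updateCol_apply, hj] using h _ (hs i')
  · simpa [Matrix.updateCol_apply, hj] using hG i' j

variable [CompleteSpace E]

theorem contMDiffAt_koszul {Y X Z : Π p : M, TangentSpace I p} {p : M}
    (hY : CMDiffAt ∞ (T% Y) p) (hX : CMDiffAt ∞ (T% X) p) (hZ : CMDiffAt ∞ (T% Z) p) :
    CMDiffAt ∞ (g.koszul Y X Z) p := by
  unfold koszul
  exact contMDiffAt_const.mul
    ((((((g.contMDiffAt_apply hY hZ).mvfderiv_apply hX).add
      ((g.contMDiffAt_apply hX hZ).mvfderiv_apply hY)).sub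
      ((g.contMDiffAt_apply hX hY).mvfderiv_apply hZ)).add
      (g.contMDiffAt_apply (contMDiffAt_mlieBracket hX hY) hZ)).sub
      (g.contMDiffAt_apply (contMDiffAt_mlieBracket hX hZ) hY)|>.sub
      (g.contMDiffAt_apply (contMDiffAt_mlieBracket hY hZ) hX))

theorem contMDiffAt_leviCivita {Y X : Π p : M, TangentSpace I p} {p : M}
    (hY : CMDiffAt ∞ (T% Y) p) (hX : CMDiffAt ∞ (T% X) p) :
    CMDiffAt ∞ (T% (fun q ↦ g.leviCivita Y q (X q))) p := by
  refine g.contMDiffAt_of_val fun Z hZ ↦ (g.contMDiffAt_koszul hY hX hZ).congr_of_eventuallyEq ?_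
  filter_upwards [hY.eventually_mdifferentiableAt, hX.eventually_mdifferentiableAt,
    hZ.eventually_mdifferentiableAt] with q h1 h2 h3
  exact g.val_leviCivitaFun h1 h2 h3

end

section

variable [CompleteSpace E]

/-- The Lie bracket of vector fields acts on functions as the commutator of derivations. -/
theorem mvfderiv_mlieBracket {f : M → ℝ} {U V : Π p : M, TangentSpace I p} {p : M}
    (hf : CMDiffAt ∞ f p) (hU : CMDiffAt ∞ (T% U) p) (hV : CMDiffAt ∞ (T% V) p) :
    mvfderiv I f p (mlieBracket I U V p)
      = mvfderiv I (fun q ↦ mvfderiv I f q (V q)) p (U p)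
        - mvfderiv I (fun q ↦ mvfderiv I f q (U q)) p (V p) := by
  have hle2 : (2 : ℕ∞ω) ≤ ∞ := WithTop.coe_le_coe.2 (le_top : (2 : ℕ∞) ≤ ⊤)
  have hle3 : (3 : ℕ∞ω) ≤ ∞ := WithTop.coe_le_coe.2 (le_top : (3 : ℕ∞) ≤ ⊤)
  have : IsManifold I (minSmoothness ℝ 3) M := .of_le (n := ∞) (by simpa using hle3)
  have hsm {X : Π p : M, TangentSpace I p} (hX : CMDiffAt ∞ (T% X) p) :
      CMDiffAt (minSmoothness ℝ 2) (T% X) p := ContMDiffAt.of_le hX (by simpa using hle2)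
  have hd {X : Π p : M, TangentSpace I p} (hX : CMDiffAt ∞ (T% X) p) : MDiffAt (T% X) p :=
    hX.mdifferentiableAt (by simp)
  have hdf {f : M → ℝ} (hX : CMDiffAt ∞ f p) : MDiffAt f p :=
    hX.mdifferentiableAt (by simp)
  rcases subsingleton_or_nontrivial E with hE | hE
  · have h0 : ∀ v : TangentSpace I p, v = 0 := fun v ↦ Subsingleton.elim (α := E) v 0
    rw [h0 (mlieBracket I U V p), h0 (U p), h0 (V p)]
    simp
  have : Nontrivial (TangentSpace I p) := inferInstanceAs (Nontrivial E)
  obtain ⟨w, hw⟩ := exists_ne (0 : TangentSpace I p)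
  let W := FiberBundle.extend E w
  have hW : CMDiffAt ∞ (T% W) p := FiberBundle.contMDiffAt_extend I E _
  have key {X : Π p : M, TangentSpace I p} : mlieBracket I X (f • W)
      =ᶠ[𝓝 p] (fun q ↦ mvfderiv I f q (X q)) • W + f • mlieBracket I X W := by
    filter_upwards [hf.eventually_mdifferentiableAt_fun, hW.eventually_mdifferentiableAt]
      with q h1 h2
    exact mlieBracket_smul_right h1 h2
  have second {X Y : Π p : M, TangentSpace I p} (hX : CMDiffAt ∞ (T% X) p)
      (hY : CMDiffAt ∞ (T% Y) p) : mlieBracket I X (mlieBracket I Y (f • W)) p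
      = mvfderiv I (fun q ↦ mvfderiv I f q (Y q)) p (X p) • W p
        + mvfderiv I f p (Y p) • mlieBracket I X W p
        + (mvfderiv I f p (X p) • mlieBracket I Y W p
        + f p • mlieBracket I X (mlieBracket I Y W) p) := by
    rw [Filter.EventuallyEq.mlieBracket_vectorField_eq (EventuallyEq.refl _ X) key,
      mlieBracket_add_right, mlieBracket_smul_right, mlieBracket_smul_right]
    · exact hdf hf
    · exact hd (contMDiffAt_mlieBracket hY hW)
    · exact hdf (hf.mvfderiv_apply hY)
    · exact hd hW
    · exact (hdf (hf.mvfderiv_apply hY)).smul_section (hd hW)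
    · exact (hdf hf).smul_section (hd (contMDiffAt_mlieBracket hY hW))
  have J1 := leibniz_identity_mlieBracket_apply (hsm hU) (hsm hV) (hsm (hf.smul_section hW))
  have J2 := leibniz_identity_mlieBracket_apply (hsm hU) (hsm hV) (hsm hW)
  rw [second hU hV, second hV hU, mlieBracket_smul_right (hdf hf) (hd hW), J2] at J1
  have hWp : W p = w := FiberBundle.extend_apply_self E w
  have h0 : (mvfderiv I f p (mlieBracket I U V p)
      - (mvfderiv I (fun q ↦ mvfderiv I f q (V q)) p (U p)
        - mvfderiv I (fun q ↦ mvfderiv I f q (U q)) p (V p))) • W p = 0 := by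
    rw [← sub_eq_zero] at J1
    rw [← neg_eq_zero, ← J1]
    module
  rw [hWp] at h0
  exact sub_eq_zero.1 ((smul_eq_zero.1 h0).resolve_right hw)

variable [FiniteDimensional ℝ E]

/-- The curvature operator `R(U,V)W` on vector fields. -/
def curvatureField (U V W : Π p : M, TangentSpace I p) (p : M) : TangentSpace I p :=
  g.leviCivita (fun q ↦ g.leviCivita W q (V q)) p (U p)
    - g.leviCivita (fun q ↦ g.leviCivita W q (U q)) p (V p)
    - g.leviCivita W p (mlieBracket I U V p)

theorem mvfderiv_mvfderiv_val {U V W Z : Π p : M, TangentSpace I p} {p : M}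
    (hU : CMDiffAt ∞ (T% U) p) (hV : CMDiffAt ∞ (T% V) p)
    (hW : CMDiffAt ∞ (T% W) p) (hZ : CMDiffAt ∞ (T% Z) p) :
    mvfderiv I (fun q ↦ mvfderiv I (fun q ↦ g.val q (W q) (Z q)) q (V q)) p (U p)
      = g.val p (g.leviCivita (fun q ↦ g.leviCivita W q (V q)) p (U p)) (Z p)
        + g.val p (g.leviCivita W p (V p)) (g.leviCivita Z p (U p))
        + g.val p (g.leviCivita W p (U p)) (g.leviCivita Z p (V p))
        + g.val p (W p) (g.leviCivita (fun q ↦ g.leviCivita Z q (V q)) p (U p)) := by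
  have hd {X : Π p : M, TangentSpace I p} (hX : CMDiffAt ∞ (T% X) p) : MDiffAt (T% X) p :=
    hX.mdifferentiableAt (by simp)
  have h : (fun q ↦ mvfderiv I (fun q ↦ g.val q (W q) (Z q)) q (V q)) =ᶠ[𝓝 p]
      fun q ↦ g.val q (g.leviCivita W q (V q)) (Z q) + g.val q (W q) (g.leviCivita Z q (V q)) := by
    filter_upwards [hV.eventually_mdifferentiableAt, hW.eventually_mdifferentiableAt,
      hZ.eventually_mdifferentiableAt] with q h1 h2 h3
    exact g.leviCivita_metric h1 h2 h3
  have h1 := hd (g.contMDiffAt_leviCivita hW hV)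
  have h2 := hd (g.contMDiffAt_leviCivita hZ hV)
  rw [h.mvfderiv_eq, mvfderiv_fun_add (g.mdifferentiableAt_apply h1 (hd hZ))
    (g.mdifferentiableAt_apply (hd hW) h2), add_apply, g.leviCivita_metric (hd hU) h1 (hd hZ),
    g.leviCivita_metric (hd hU) (hd hW) h2]
  ring

/-- `R(U,V)` is skew-adjoint. -/
theorem val_curvatureField {U V W Z : Π p : M, TangentSpace I p} {p : M}
    (hU : CMDiffAt ∞ (T% U) p) (hV : CMDiffAt ∞ (T% V) p)
    (hW : CMDiffAt ∞ (T% W) p) (hZ : CMDiffAt ∞ (T% Z) p) :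
    g.val p (g.curvatureField U V W p) (Z p) = - g.val p (W p) (g.curvatureField U V Z p) := by
  have hd {X : Π p : M, TangentSpace I p} (hX : CMDiffAt ∞ (T% X) p) : MDiffAt (T% X) p :=
    hX.mdifferentiableAt (by simp)
  have h1 := mvfderiv_mlieBracket (g.contMDiffAt_apply hW hZ) hU hV
  rw [g.mvfderiv_mvfderiv_val hU hV hW hZ, g.mvfderiv_mvfderiv_val hV hU hW hZ,
    g.leviCivita_metric (hd (contMDiffAt_mlieBracket hU hV)) (hd hW) (hd hZ)] at h1
  simp only [curvatureField, map_sub, sub_apply]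
  linear_combination -h1

end
end PseudoRiemannianMetric

namespace PseudoRiemannianMetric

open VectorField Filter Topology

variable {E : Type*} [NormedAddCommGroup E] [NormedSpace ℝ E] [CompleteSpace E]
  [FiniteDimensional ℝ E]
  {H : Type*} [TopologicalSpace H] {I : ModelWithCorners ℝ E H}
  {M : Type*} [TopologicalSpace M] [ChartedSpace H M] [IsManifold I ∞ M]
  (g : PseudoRiemannianMetric I M)

theorem leviCivita_clm_apply {φ : Π p : M, TangentSpace I p →L[ℝ] TangentSpace I p}
    {Y : Π p : M, TangentSpace I p} {p : M}
    (hφ : MDifferentiableAt I (I.prod 𝓘(ℝ, E →L[ℝ] E)) (fun q ↦ Bundle.TotalSpace.mk' (E →L[ℝ] E)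
      (E := fun p : M ↦ TangentSpace I p →L[ℝ] TangentSpace I p) q (φ q)) p)
    (hY : MDiffAt (T% Y) p) (u : TangentSpace I p) :
    g.leviCivita (fun q ↦ φ q (Y q)) p u
      = g.covDerivEnd φ p u (Y p) + φ p (g.leviCivita Y p u) := by
  have hφY {Y : Π p : M, TangentSpace I p} (hY : MDiffAt (T% Y) p) :
      MDiffAt (T% (fun q ↦ φ q (Y q))) p := hφ.clm_bundle_apply hY
  have hc := g.leviCivita.isCovariantDerivativeOnUniv
  have htens : TensorialAt I E (fun Y : Π p : M, TangentSpace I p ↦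
      g.leviCivita (fun q ↦ φ q (Y q)) p u - φ p (g.leviCivita Y p u)) p :=
    { smul := fun {f Y} hf hY ↦ by
        have h1 : (fun q ↦ φ q ((f • Y) q)) = f • fun q ↦ φ q (Y q) := by
          ext1 q; simp
        have h2 := hc.leibniz hY hf
        have h3 := hc.leibniz (hφY hY) hf
        change g.leviCivita _ _ = _ at h2 h3
        simp only [h1, h2, h3]
        simp [smul_sub]
      add := fun {Y Y'} hY hY' ↦ by
        have h1 : (fun q ↦ φ q ((Y + Y') q)) = (fun q ↦ φ q (Y q)) + fun q ↦ φ q (Y' q) := by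
          ext1 q; simp
        have h2 := hc.add hY hY'
        have h3 := hc.add (hφY hY) (hφY hY')
        change g.leviCivita _ _ = _ at h2 h3
        simp only [h1, h2, h3]
        simp
        abel }
  have := htens.pointwise hY (FiberBundle.mdifferentiableAt_extend I E (Y p)) (by simp)
  rw [covDerivEnd, ← this, sub_add_cancel]

theorem _root_.Module.Basis.sum_repr_apply_eq_trace {ι V : Type*} [Fintype ι] [AddCommGroup V]
    [Module ℝ V] (b : Module.Basis ι ℝ V) (A : V →ₗ[ℝ] V) :
    ∑ i, b.repr (A (b i)) i = LinearMap.trace ℝ V A := by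
  classical
  simp [LinearMap.trace_eq_matrix_trace ℝ b, Matrix.trace, LinearMap.toMatrix_apply]

theorem ricci_eq_trace (p : M) (v w : TangentSpace I p)
    (A : TangentSpace I p →ₗ[ℝ] TangentSpace I p)
    (h : ∀ u, g.curvature p u v w = A u) :
    g.ricci p v w = LinearMap.trace ℝ (TangentSpace I p) A := by
  simp only [ricci, h]
  exact Module.Basis.sum_repr_apply_eq_trace _ A

end PseudoRiemannianMetric

namespace AlmostContactBMetric

open VectorField Filter Topology

variable {n : ℕ} {M : Type*} [TopologicalSpace M]
  [ChartedSpace (EuclideanSpace ℝ (Fin (2 * n + 1))) M] [IsManifold (𝓡 (2 * n + 1)) ∞ M]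
  (S : AlmostContactBMetric n M)

theorem g_ξ (p : M) (x : TangentSpace (𝓡 (2 * n + 1)) p) : S.g.val p (S.ξ p) x = S.η p x := by
  have := S.g_φ_φ p (S.ξ p) x
  rw [S.φ_ξ, S.η_ξ] at this
  simp at this
  linarith

theorem g_ξ_right (p : M) (x : TangentSpace (𝓡 (2 * n + 1)) p) :
    S.g.val p x (S.ξ p) = S.η p x := by
  rw [S.g.symm, S.g_ξ]

theorem g_φ_left (p : M) (x y : TangentSpace (𝓡 (2 * n + 1)) p) :
    S.g.val p (S.φ p x) y = S.g.val p x (S.φ p y) := by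
  have := S.g_φ_φ p (S.φ p x) y
  rw [S.φ_φ, S.η_φ] at this
  simp [S.g_ξ, S.η_φ] at this
  linarith

theorem mdifferentiableAt_ξ (p : M) : MDifferentiableAt (𝓡 (2 * n + 1)) (𝓡 (2 * n + 1)).tangent
      (fun q ↦ (⟨q, S.ξ q⟩ : TangentBundle (𝓡 (2 * n + 1)) M)) p :=
  S.contMDiff_ξ.mdifferentiableAt (by simp)

theorem leviCivita_φ (p : M) {Y : Π p : M, TangentSpace (𝓡 (2 * n + 1)) p}
    (hY : MDifferentiableAt (𝓡 (2 * n + 1)) (𝓡 (2 * n + 1)).tangent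
      (fun q ↦ (⟨q, Y q⟩ : TangentBundle (𝓡 (2 * n + 1)) M)) p)
    (u : TangentSpace (𝓡 (2 * n + 1)) p) :
    S.g.leviCivita (fun q ↦ S.φ q (Y q)) p u
      = S.g.covDerivEnd S.φ p u (Y p) + S.φ p (S.g.leviCivita Y p u) :=
  S.g.leviCivita_clm_apply (S.contMDiff_φ.mdifferentiableAt (by simp)) hY u

theorem mdifferentiableAt_φ_apply {p : M} {Y : Π p : M, TangentSpace (𝓡 (2 * n + 1)) p}
    (hY : MDifferentiableAt (𝓡 (2 * n + 1)) (𝓡 (2 * n + 1)).tangent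
      (fun q ↦ (⟨q, Y q⟩ : TangentBundle (𝓡 (2 * n + 1)) M)) p) :
    MDifferentiableAt (𝓡 (2 * n + 1)) (𝓡 (2 * n + 1)).tangent
      (fun q ↦ (⟨q, S.φ q (Y q)⟩ : TangentBundle (𝓡 (2 * n + 1)) M)) p :=
  (S.contMDiff_φ.mdifferentiableAt (x := p) (by simp)).clm_bundle_apply hY

theorem η_leviCivita_ξ (p : M) (u : TangentSpace (𝓡 (2 * n + 1)) p) :
    S.η p (S.g.leviCivita S.ξ p u) = 0 := by
  have h := S.g.leviCivita_metric (FiberBundle.mdifferentiableAt_extend (𝓡 (2 * n + 1)) _ u)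
    (S.mdifferentiableAt_ξ p) (S.mdifferentiableAt_ξ p)
  simp only [S.g_ξ, S.g_ξ_right, S.η_ξ, FiberBundle.extend_apply_self] at h
  rw [mvfderiv_const] at h
  simp at h
  linarith

variable {S}

theorem IsSasakiLike.leviCivita_ξ (hS : S.IsSasakiLike) (p : M)
    (u : TangentSpace (𝓡 (2 * n + 1)) p) : S.g.leviCivita S.ξ p u = - S.φ p u := by
  have h := S.leviCivita_φ p (S.mdifferentiableAt_ξ p) u
  have h0 : (fun q ↦ S.φ q (S.ξ q)) = 0 := funext fun q ↦ S.φ_ξ q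
  have hz : S.g.leviCivita (0 : Π p : M, TangentSpace (𝓡 (2 * n + 1)) p) p = 0 :=
    S.g.leviCivita.isCovariantDerivativeOnUniv.zero
  rw [h0, hz, hS, S.g_ξ_right, S.η_ξ] at h
  have h1 := congr(S.φ p $h)
  have h2 := S.φ_φ p (S.g.leviCivita S.ξ p u)
  rw [S.η_leviCivita_ξ] at h2
  simp [S.φ_ξ, h2] at h1
  exact (add_neg_eq_zero.1 h1.symm).symm

theorem IsSasakiLike.curvature_ξ (hS : S.IsSasakiLike) (p : M)
    (u v : TangentSpace (𝓡 (2 * n + 1)) p) :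
    S.g.curvature p u v (S.ξ p) = S.η p v • u - S.η p u • v := by
  refine S.g.eq_of_val_eq fun w ↦ ?_
  let U := FiberBundle.extend (EuclideanSpace ℝ (Fin (2 * n + 1))) u
  let V := FiberBundle.extend (EuclideanSpace ℝ (Fin (2 * n + 1))) v
  let W := FiberBundle.extend (EuclideanSpace ℝ (Fin (2 * n + 1))) (S.ξ p)
  have hsm (x : TangentSpace (𝓡 (2 * n + 1)) p) :
      ContMDiffAt (𝓡 (2 * n + 1)) (𝓡 (2 * n + 1)).tangent ∞
      (fun q ↦ (⟨q, (FiberBundle.extend (EuclideanSpace ℝ (Fin (2 * n + 1))) x) q⟩ :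
        TangentBundle (𝓡 (2 * n + 1)) M)) p :=
    FiberBundle.contMDiffAt_extend (𝓡 (2 * n + 1)) _ x
  have hd (x : TangentSpace (𝓡 (2 * n + 1)) p) :
      MDifferentiableAt (𝓡 (2 * n + 1)) (𝓡 (2 * n + 1)).tangent
      (fun q ↦ (⟨q, (FiberBundle.extend (EuclideanSpace ℝ (Fin (2 * n + 1))) x) q⟩ :
        TangentBundle (𝓡 (2 * n + 1)) M)) p :=
    FiberBundle.mdifferentiableAt_extend (𝓡 (2 * n + 1)) _ x
  have h1 : S.g.curvature p u v (S.ξ p) = S.g.curvatureField U V W p := by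
    simp [PseudoRiemannianMetric.curvature, PseudoRiemannianMetric.curvatureField, U, V, W]
  have h2 := S.g.val_curvatureField (hsm u) (hsm v) (hsm (S.ξ p)) (hsm w)
  have h3 := S.g.val_curvatureField (hsm u) (hsm v) S.contMDiff_ξ.contMDiffAt (hsm w)
  rw [FiberBundle.extend_apply_self, FiberBundle.extend_apply_self] at h2
  rw [FiberBundle.extend_apply_self] at h3
  have hneg {Y : Π p : M, TangentSpace (𝓡 (2 * n + 1)) p}
      (hY : MDifferentiableAt (𝓡 (2 * n + 1)) (𝓡 (2 * n + 1)).tangent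
      (fun q ↦ (⟨q, Y q⟩ : TangentBundle (𝓡 (2 * n + 1)) M)) p)
      (x : TangentSpace (𝓡 (2 * n + 1)) p) :
      S.g.leviCivita (fun q ↦ S.g.leviCivita S.ξ q (Y q)) p x
        = - (S.g.covDerivEnd S.φ p x (Y p) + S.φ p (S.g.leviCivita Y p x)) := by
    simp only [hS.leviCivita_ξ]
    have h := S.g.leviCivita.isCovariantDerivativeOnUniv.smul_const (-1 : ℝ)
      (S.mdifferentiableAt_φ_apply hY)
    rw [← S.leviCivita_φ p hY]
    have h' := congr($h x)
    simpa [Pi.smul_def] using! h'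
  have h4 : S.g.curvatureField U V S.ξ p = S.η p v • u - S.η p u • v := by
    have ht := S.g.leviCivita_torsionFree (hd u) (hd v)
    rw [PseudoRiemannianMetric.curvatureField, hneg (hd v), hneg (hd u), hS.leviCivita_ξ, ← ht, hS,
      hS]
    simp only [U, V, FiberBundle.extend_apply_self, map_sub, S.g.symm p v u]
    module
  rw [h1, h2, ← h3, h4]

theorem IsSasakiLike.ρ_ξ_ξ (hS : S.IsSasakiLike) (p : M) : S.ρ p (S.ξ p) (S.ξ p) = 2 * n := by
  rw [ρ, S.g.ricci_eq_trace p _ _ (LinearMap.id - (S.η p).toLinearMap.smulRight (S.ξ p))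
    fun u ↦ by simp [hS.curvature_ξ, S.η_ξ], map_sub, LinearMap.trace_smulRight,
    LinearMap.trace_id]
  have : Module.finrank ℝ (TangentSpace (𝓡 (2 * n + 1)) p) = 2 * n + 1 :=
    finrank_euclideanSpace_fin (𝕜 := ℝ)
  simp [this, S.η_ξ]

end AlmostContactBMetric

theorem Matrix.trace_eq_zero_of_cube_eq_neg {ι : Type*} [Fintype ι] [DecidableEq ι]
    {A : Matrix ι ι ℝ} (h : A * A * A = -A) : A.trace = 0 := by
  let B : Matrix ι ι ℂ := A.map (algebraMap ℝ ℂ)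
  have hB : B * B * B = -B := by
    have := congr_arg (fun C : Matrix ι ι ℝ ↦ C.map (algebraMap ℝ ℂ)) h
    simpa only [Matrix.map_mul, Matrix.map_neg (algebraMap ℝ ℂ) (by simp)] using this
  have htr : B.trace = (A.trace : ℂ) := by simp [B, Matrix.trace]
  have hroot : ∀ μ ∈ B.charpoly.roots, μ.re = 0 := by
    intro μ hμ
    have hev : Module.End.HasEigenvalue (Matrix.toLin' B) μ := by
      rw [Module.End.hasEigenvalue_iff_isRoot_charpoly, Matrix.charpoly_toLin']
      exact Polynomial.isRoot_of_mem_roots hμ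
    obtain ⟨v, hv⟩ := hev.exists_hasEigenvector
    have hv1 : B.mulVec v = μ • v := by simpa using hv.apply_eq_smul
    have hv2 := congr_arg (fun C : Matrix ι ι ℂ ↦ C.mulVec v) hB
    simp only [← Matrix.mulVec_mulVec, Matrix.neg_mulVec, hv1, Matrix.mulVec_smul] at hv2
    have hv3 : (μ * (μ * μ + 1)) • v = 0 := by
      rw [mul_add, add_smul, mul_one, ← add_neg_cancel (μ • v), add_comm (μ • v), ← hv2]
      simp only [mul_smul]
    have hμ0 := (smul_eq_zero.1 hv3).resolve_right hv.2
    rcases mul_eq_zero.1 hμ0 with h0 | h0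
    · simp [h0]
    · have h1 : μ * μ = Complex.I * Complex.I := by
        rw [Complex.I_mul_I]; linear_combination h0
      rcases mul_self_eq_mul_self_iff.1 h1 with h2 | h2 <;> simp [h2]
  have hre : B.trace.re = 0 := by
    rw [Matrix.trace_eq_sum_roots_charpoly]
    have : (B.charpoly.roots.sum).re = (B.charpoly.roots.map Complex.re).sum :=
      map_multiset_sum Complex.reAddGroupHom _
    rw [this]
    exact Multiset.sum_eq_zero fun x hx ↦ by
      obtain ⟨μ, hμ, rfl⟩ := Multiset.mem_map.1 hx
      exact hroot μ hμ
  simpa [htr] using hre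

theorem LinearMap.trace_eq_zero_of_cube_eq_neg {V : Type*} [AddCommGroup V] [Module ℝ V]
    [FiniteDimensional ℝ V] {A : V →ₗ[ℝ] V} (h : ∀ v, A (A (A v)) = -A v) :
    LinearMap.trace ℝ V A = 0 := by
  classical
  let b := Module.finBasis ℝ V
  rw [LinearMap.trace_eq_matrix_trace ℝ b]
  refine Matrix.trace_eq_zero_of_cube_eq_neg ?_
  have h' : A ∘ₗ A ∘ₗ A = -A := LinearMap.ext fun v ↦ by simp [h]
  rw [Matrix.mul_assoc, ← LinearMap.toMatrix_comp b b b, ← LinearMap.toMatrix_comp b b b, h', map_neg]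

theorem mvfderiv_linear_add_mul {E : Type*} [NormedAddCommGroup E] [NormedSpace ℝ E]
    {H : Type*} [TopologicalSpace H] {I : ModelWithCorners ℝ E H}
    {M : Type*} [TopologicalSpace M] [ChartedSpace H M] {f₁ f₂ f₃ f₄ : M → ℝ} {p : M}
    (h₁ : MDiffAt f₁ p) (h₂ : MDiffAt f₂ p) (h₃ : MDiffAt f₃ p) (h₄ : MDiffAt f₄ p) (a b c : ℝ)
    (v : TangentSpace I p) :
    mvfderiv I (fun q ↦ a * f₁ q + b * f₂ q + c * (f₃ q * f₄ q)) p v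
      = a * mvfderiv I f₁ p v + b * mvfderiv I f₂ p v
        + c * (f₃ p * mvfderiv I f₄ p v + f₄ p * mvfderiv I f₃ p v) := by
  have hc (r : ℝ) : MDiffAt (fun _ : M ↦ r) p := mdifferentiableAt_const
  have h34 : MDiffAt (fun q ↦ f₃ q * f₄ q) p := h₃.mul h₄
  have k₁ : MDiffAt (fun q ↦ a * f₁ q) p := (hc a).mul h₁
  have k₂ : MDiffAt (fun q ↦ b * f₂ q) p := (hc b).mul h₂
  have k₃ : MDiffAt (fun q ↦ c * (f₃ q * f₄ q)) p := (hc c).mul h34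
  have k₁₂ : MDiffAt (fun q ↦ a * f₁ q + b * f₂ q) p := k₁.add k₂
  rw [mvfderiv_fun_add k₁₂ k₃, mvfderiv_fun_add k₁ k₂, mvfderiv_fun_mul (hc a) h₁,
    mvfderiv_fun_mul (hc b) h₂, mvfderiv_fun_mul (hc c) h34, mvfderiv_fun_mul h₃ h₄]
  simp [mvfderiv_const]
  ring

namespace PseudoRiemannianMetric

variable {E : Type*} [NormedAddCommGroup E] [NormedSpace ℝ E]
  [FiniteDimensional ℝ E]
  {H : Type*} [TopologicalSpace H] {I : ModelWithCorners ℝ E H}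
  {M : Type*} [TopologicalSpace M] [ChartedSpace H M] [IsManifold I ∞ M]

theorem traceWith_eq_trace {p : M} {h T : TangentSpace I p → TangentSpace I p → ℝ}
    (B : TangentSpace I p →ₗ[ℝ] TangentSpace I p →ₗ[ℝ] ℝ)
    (A : TangentSpace I p →ₗ[ℝ] TangentSpace I p)
    (hB : ∀ u v, h u v = B u v) (hsymm : ∀ u v, B u v = B v u)
    (hnd : ∀ u, (∀ v, B u v = 0) → u = 0) (hT : ∀ u v, T u v = B u (A v)) :
    traceWith h T = LinearMap.trace ℝ (TangentSpace I p) A := by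
  classical
  rw [traceWith]
  generalize tangentBasis I p = b
  let G : Matrix _ _ ℝ := Matrix.of fun i j ↦ B (b i) (b j)
  have hG : (Matrix.of fun i j ↦ h (b i) (b j)) = G := by
    ext i j; simp [G, hB]
  have hGs : G.transpose = G := by
    ext i j; simp [G, hsymm (b i)]
  have hdet : IsUnit G.det := by
    rw [isUnit_iff_ne_zero]
    intro hzero
    obtain ⟨v, hv, hGv⟩ := Matrix.exists_mulVec_eq_zero_iff.2 hzero
    have hu : ∑ j, v j • b j = 0 := by
      refine hnd _ fun w ↦ ?_
      rw [← b.sum_repr w]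
      simp only [map_sum, map_smul]
      refine Finset.sum_eq_zero fun i _ ↦ ?_
      have := congr_fun hGv i
      simp only [Matrix.mulVec, dotProduct, G, Matrix.of_apply, Pi.zero_apply] at this
      simp [mul_comm (v _), hsymm _ (b i), this]
    exact hv (funext fun i ↦ Fintype.linearIndependent_iff.1 b.linearIndependent v hu i)
  have hTm : ∀ i j, T (b i) (b j) = (G * LinearMap.toMatrix b b A) i j := by
    intro i j
    rw [hT]
    conv_lhs => rw [← b.sum_repr (A (b j))]
    simp only [map_sum, map_smul, smul_eq_mul, Matrix.mul_apply, G, Matrix.of_apply,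
      LinearMap.toMatrix_apply, mul_comm]
  rw [hG, LinearMap.trace_eq_matrix_trace ℝ b]
  calc _ = ∑ i, ∑ j, G⁻¹ j i * (G * LinearMap.toMatrix b b A) i j := by
        refine Finset.sum_congr rfl fun i _ ↦ Finset.sum_congr rfl fun j _ ↦ ?_
        rw [hTm, ← Matrix.transpose_apply G⁻¹, Matrix.transpose_nonsing_inv, hGs]
    _ = (G⁻¹ * (G * LinearMap.toMatrix b b A)).trace := by
        rw [Finset.sum_comm]
        simp [Matrix.trace, Matrix.mul_apply]
    _ = _ := by rw [← Matrix.mul_assoc, Matrix.nonsing_inv_mul _ hdet, Matrix.one_mul]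

end PseudoRiemannianMetric

namespace AlmostContactBMetric

open VectorField Filter Topology

theorem finrank_tangentSpace {n : ℕ} {M : Type*} [TopologicalSpace M]
    [ChartedSpace (EuclideanSpace ℝ (Fin (2 * n + 1))) M] (p : M) :
    Module.finrank ℝ (TangentSpace (𝓡 (2 * n + 1)) p) = 2 * n + 1 :=
  finrank_euclideanSpace_fin (𝕜 := ℝ)

variable {n : ℕ} {M : Type*} [TopologicalSpace M]
  [ChartedSpace (EuclideanSpace ℝ (Fin (2 * n + 1))) M] [IsManifold (𝓡 (2 * n + 1)) ∞ M]
  (S : AlmostContactBMetric n M)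

theorem trace_φ (p : M) :
    LinearMap.trace ℝ (TangentSpace (𝓡 (2 * n + 1)) p) (S.φ p).toLinearMap = 0 :=
  LinearMap.trace_eq_zero_of_cube_eq_neg fun v ↦ by simp [S.φ_φ, S.φ_ξ]

theorem trace_η_ξ (p : M) : LinearMap.trace ℝ (TangentSpace (𝓡 (2 * n + 1)) p)
    ((S.η p).toLinearMap.smulRight (S.ξ p)) = 1 := by
  rw [LinearMap.trace_smulRight]
  exact S.η_ξ p

/-- The metric as a bilinear map. -/
def bilin (p : M) : TangentSpace (𝓡 (2 * n + 1)) p →ₗ[ℝ] TangentSpace (𝓡 (2 * n + 1)) p →ₗ[ℝ] ℝ :=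
  LinearMap.mk₂ ℝ (fun u v ↦ S.g.val p u v) (by simp) (by simp) (by simp) (by simp)

/-- The associated metric as a bilinear map. -/
def assocBilin (p : M) :
    TangentSpace (𝓡 (2 * n + 1)) p →ₗ[ℝ] TangentSpace (𝓡 (2 * n + 1)) p →ₗ[ℝ] ℝ :=
  LinearMap.mk₂ ℝ (S.assocMetric p)
    (by intros; simp [assocMetric]; ring) (by intros; simp [assocMetric]; ring)
    (by intros; simp [assocMetric]; ring) (by intros; simp [assocMetric]; ring)

theorem traceWith_g (p : M) {T : TangentSpace (𝓡 (2 * n + 1)) p → TangentSpace (𝓡 (2 * n + 1)) p → ℝ}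
    (A : TangentSpace (𝓡 (2 * n + 1)) p →ₗ[ℝ] TangentSpace (𝓡 (2 * n + 1)) p)
    (hT : ∀ u v, T u v = S.g.val p u (A v)) :
    PseudoRiemannianMetric.traceWith (fun u v ↦ S.g.val p u v) T = LinearMap.trace ℝ _ A :=
  PseudoRiemannianMetric.traceWith_eq_trace (S.bilin p) A (fun _ _ ↦ rfl) (S.g.symm p)
    (S.g.nondegenerate p) hT

theorem traceWith_assocMetric (p : M)
    {T : TangentSpace (𝓡 (2 * n + 1)) p → TangentSpace (𝓡 (2 * n + 1)) p → ℝ}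
    (A : TangentSpace (𝓡 (2 * n + 1)) p →ₗ[ℝ] TangentSpace (𝓡 (2 * n + 1)) p)
    (hT : ∀ u v, T u v = S.assocMetric p u (A v)) :
    PseudoRiemannianMetric.traceWith (S.assocMetric p) T = LinearMap.trace ℝ _ A := by
  refine PseudoRiemannianMetric.traceWith_eq_trace (S.assocBilin p) A (fun _ _ ↦ rfl)
    (fun u v ↦ ?_) (fun u hu ↦ ?_) hT
  · change S.assocMetric p u v = S.assocMetric p v u
    rw [assocMetric, assocMetric, ← S.g_φ_left, S.g.symm, mul_comm (S.η p u)]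
  · change ∀ v, S.assocMetric p u v = 0 at hu
    simp only [assocMetric] at hu
    have h1 : S.η p u = 0 := by simpa [S.φ_ξ, S.η_ξ] using hu (S.ξ p)
    have h2 : S.φ p u = 0 := S.g.nondegenerate p _ fun v ↦ by
      simpa [S.g_φ_left, h1] using hu v
    simpa [h1, h2] using S.φ_φ p u

variable {S}

theorem IsEinsteinLike.nablaRho_eq {a b c : ℝ} (hE : S.IsEinsteinLike a b c)
    (hS : S.IsSasakiLike) (p : M) (x y z : TangentSpace (𝓡 (2 * n + 1)) p) :
    S.nablaRho p x y z =
      -(b + c) * (S.g.val p x (S.φ p y) * S.η p z + S.g.val p x (S.φ p z) * S.η p y)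
      + b * (S.g.val p (S.φ p x) (S.φ p y) * S.η p z
        + S.g.val p (S.φ p x) (S.φ p z) * S.η p y) := by
  let Y := FiberBundle.extend (EuclideanSpace ℝ (Fin (2 * n + 1))) y
  let Z := FiberBundle.extend (EuclideanSpace ℝ (Fin (2 * n + 1))) z
  have hX := FiberBundle.mdifferentiableAt_extend (𝓡 (2 * n + 1))
    (EuclideanSpace ℝ (Fin (2 * n + 1))) x
  have hY := FiberBundle.mdifferentiableAt_extend (𝓡 (2 * n + 1))
    (EuclideanSpace ℝ (Fin (2 * n + 1))) y
  have hZ := FiberBundle.mdifferentiableAt_extend (𝓡 (2 * n + 1))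
    (EuclideanSpace ℝ (Fin (2 * n + 1))) z
  have hξ := S.mdifferentiableAt_ξ p
  have hφZ := S.mdifferentiableAt_φ_apply hZ
  have hfun : (fun q ↦ S.ρ q (Y q) (Z q)) = fun q ↦ a * S.g.val q (Y q) (Z q)
      + b * S.g.val q (Y q) (S.φ q (Z q))
      + (b + c) * (S.g.val q (S.ξ q) (Y q) * S.g.val q (S.ξ q) (Z q)) := by
    ext q
    rw [hE, assocMetric, S.g_ξ, S.g_ξ]
    ring
  have d1 := S.g.mdifferentiableAt_apply hY hZ
  have d2 := S.g.mdifferentiableAt_apply hY hφZ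
  have d3 := S.g.mdifferentiableAt_apply hξ hY
  have d4 := S.g.mdifferentiableAt_apply hξ hZ
  have e1 := S.g.leviCivita_metric hX hY hZ
  have e2 := S.g.leviCivita_metric hX hY hφZ
  have e3 := S.g.leviCivita_metric hX hξ hY
  have e4 := S.g.leviCivita_metric hX hξ hZ
  rw [S.leviCivita_φ p hZ] at e2
  rw [hS.leviCivita_ξ] at e3 e4
  simp only [FiberBundle.extend_apply_self] at e1 e2 e3 e4
  rw [hS] at e2
  rw [nablaRho, PseudoRiemannianMetric.covDerivBilin, hfun,
    mvfderiv_linear_add_mul d1 d2 d3 d4, hE, hE, e1, e2, e3, e4]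
  simp only [map_add, map_sub, map_neg, map_smul, neg_apply, smul_eq_mul,
    FiberBundle.extend_apply_self, assocMetric, S.g_ξ, S.g_ξ_right, S.g_φ_φ,
    S.g_φ_left, S.g.symm p y x, S.g.symm p y (S.φ p _)]
  ring

theorem IsEinsteinLike.τ_eq {a b c : ℝ} (hE : S.IsEinsteinLike a b c) (p : M) :
    S.τ p = a * (2 * n + 1) + b + c := by
  rw [τ, PseudoRiemannianMetric.scalarCurvature, S.traceWith_g p
    (a • LinearMap.id + b • (S.φ p).toLinearMap
      + (b + c) • (S.η p).toLinearMap.smulRight (S.ξ p)) fun u v ↦ ?_]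
  · simp only [map_add, map_smul, S.trace_φ, LinearMap.trace_id,
      finrank_tangentSpace, S.trace_η_ξ, smul_eq_mul]
    push_cast
    ring
  · have := hE p u v
    rw [ρ, assocMetric] at this
    simp [this, S.g_ξ_right]
    ring

theorem IsEinsteinLike.divRho_ξ {a b c : ℝ} (hE : S.IsEinsteinLike a b c)
    (hS : S.IsSasakiLike) (p : M) : S.divRho p (S.ξ p) = -(2 * n * b) := by
  rw [divRho, PseudoRiemannianMetric.divergenceWith, S.traceWith_g p
    (-(b + c) • (S.φ p).toLinearMap - b • LinearMap.id
      + b • (S.η p).toLinearMap.smulRight (S.ξ p)) fun u v ↦ ?_]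
  · simp only [map_add, map_sub, map_smul, S.trace_φ, LinearMap.trace_id,
      finrank_tangentSpace, S.trace_η_ξ, smul_eq_mul]
    push_cast
    ring
  · have := hE.nablaRho_eq hS p u v (S.ξ p)
    rw [nablaRho] at this
    simp [this, S.g_ξ_right, S.g_φ_φ, S.φ_ξ, S.η_ξ]
    ring

theorem IsEinsteinLike.divStarRho_ξ {a b c : ℝ} (hE : S.IsEinsteinLike a b c)
    (hS : S.IsSasakiLike) (p : M) : S.divStarRho p (S.ξ p) = -(2 * n * (b + c)) := by
  rw [divStarRho, PseudoRiemannianMetric.divergenceWith, S.traceWith_assocMetric p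
    (b • (S.φ p).toLinearMap - (b + c) • LinearMap.id
      + (b + c) • (S.η p).toLinearMap.smulRight (S.ξ p)) fun u v ↦ ?_]
  · simp only [map_add, map_sub, map_smul, S.trace_φ, LinearMap.trace_id,
      finrank_tangentSpace, S.trace_η_ξ, smul_eq_mul]
    push_cast
    ring
  · have := hE.nablaRho_eq hS p u v (S.ξ p)
    rw [nablaRho] at this
    simp [this, S.g_ξ_right, S.g_φ_φ, S.φ_ξ, S.η_ξ, S.φ_φ, S.η_φ, assocMetric]
    ring

end AlmostContactBMetric

end

theorem mainTheorem6 {n : ℕ} (hn : 1 ≤ n) {M : Type*} [TopologicalSpace M] [Nonempty M]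
    [ChartedSpace (EuclideanSpace ℝ (Fin (2 * n + 1))) M] [IsManifold (𝓡 (2 * n + 1)) ∞ M]
    (S : AlmostContactBMetric n M) (a b c : ℝ)
    (hS : S.IsSasakiLike) (hE : S.IsEinsteinLike a b c) :
    a + b + c = 2 * n ∧
    (∀ p : M, S.τ p = 2 * n * (a + 1)) ∧
    (∀ (p : M) (x y z : TangentSpace (𝓡 (2 * n + 1)) p),
      S.nablaRho p x y z =
        -(b + c) * (S.g.val p x (S.φ p y) * S.η p z + S.g.val p x (S.φ p z) * S.η p y)
        + b * (S.g.val p (S.φ p x) (S.φ p y) * S.η p z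
          + S.g.val p (S.φ p x) (S.φ p z) * S.η p y)) ∧
    (∀ p : M,
      a = 2 * n + 1 / (2 * n) * S.divStarRho p (S.ξ p) ∧
      b = -(1 / (2 * n)) * S.divRho p (S.ξ p) ∧
      c = 1 / (2 * n) * (S.divRho p (S.ξ p) - S.divStarRho p (S.ξ p))) := by
  have hn0 : (n : ℝ) ≠ 0 := by exact_mod_cast (by omega : n ≠ 0)
  have habc : a + b + c = 2 * n := by
    obtain ⟨p⟩ := ‹Nonempty M›
    have h := hE p (S.ξ p) (S.ξ p)
    rw [hS.ρ_ξ_ξ, AlmostContactBMetric.assocMetric, S.g_ξ, S.φ_ξ, S.η_ξ] at h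
    simp at h
    linarith
  refine ⟨habc, fun p ↦ ?_, fun p x y z ↦ hE.nablaRho_eq hS p x y z, fun p ↦ ?_⟩
  · rw [hE.τ_eq]
    linear_combination habc
  · rw [hE.divRho_ξ hS, hE.divStarRho_ξ hS]
    refine ⟨?_, ?_, ?_⟩ <;> field_simp
    · linear_combination habc
    · ring
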